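/- Let $G$ be a finite connected simple graph. An edge-colouring $c:E(G)\to\mathbb N$ (not necessarily proper) is *rainbow connected* if any two vertices of $G$ are joined by a path whose edges have pairwise distinct colours, and *strongly rainbow connected* if any two vertices $u,v$ are joined by such a path of length $d_G(u,v)$. For an integer $r\ge 1$, an *$r$-edge-list assignment* of $G$ is a function $L$ assigning to each edge $e$ a set $L(e)\subseteq\mathbb N$ with at least $r$ elements, and an *$L$-edge-colouring* is a function $c:E(G)\to\mathbb N$ with $c(e)\in L(e)$ for all $e\in E(G)$. The *list rainbow connection number* $rc^\ell(G)$ (respectively, the *list strong rainbow connection number* $src^\ell(G)$) is the minimum integer $r\ge 1$ such that for every $r$-edge-list assignment $L$ of $G$ there exists an $L$-edge-colouring of $G$ that is rainbow connected (respectively, strongly rainbow connected). **Theorem.** Let $\mathsf P_{10}$ be the Petersen graph, whose vertices are the $2$-element subsets of a $5$-element set, two of them being adjacent exactly when they are disjoint. Then $$rc^\ell(\mathsf P_{10})=3\qquad\text{and}\qquad src^\ell(\mathsf P_{10})=4.$$ -/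

import Mathlib

namespace ListRainbow

variable {V : Type*} {G : SimpleGraph V}

/-- A walk is rainbow under the edge-colouring `c` if distinct edges of it have distinct colours.
It is only applied to paths, which do not repeat edges. -/
def IsRainbow (c : G.EdgeLabeling ℕ) {u v : V} (p : G.Walk u v) : Prop :=
  Set.InjOn c {e : G.edgeSet | (e : Sym2 V) ∈ p.edges}

/-- Any two vertices are connected by a rainbow path. -/
def RainbowConnected (c : G.EdgeLabeling ℕ) : Prop :=
  ∀ u v : V, ∃ p : G.Walk u v, p.IsPath ∧ IsRainbow c p

/-- Any two vertices are connected by a rainbow geodesic, that is, a rainbow path whose length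
is the distance of its end vertices. -/
def StronglyRainbowConnected (c : G.EdgeLabeling ℕ) : Prop :=
  ∀ u v : V, ∃ p : G.Walk u v, p.IsPath ∧ p.length = G.dist u v ∧ IsRainbow c p

/-- `L` is an `r`-edge-list assignment: each edge gets a list (a possibly infinite set of natural
numbers) with at least `r` elements. -/
def IsEdgeListAssignment (r : ℕ) (L : G.edgeSet → Set ℕ) : Prop :=
  ∀ e, (r : ℕ∞) ≤ (L e).encard

/-- `c` is an `L`-edge-colouring: each edge gets a colour from its own list. -/
def IsListEdgeColouring (L : G.edgeSet → Set ℕ) (c : G.EdgeLabeling ℕ) : Prop :=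
  ∀ e, c e ∈ L e

/-- The list rainbow connection number of a connected graph: the minimum positive integer `r` such
that every `r`-edge-list assignment `L` admits a rainbow connected `L`-edge-colouring. -/
noncomputable def listRainbowConnectionNumber (G : SimpleGraph V) : ℕ :=
  sInf {r : ℕ | 1 ≤ r ∧ ∀ L : G.edgeSet → Set ℕ, IsEdgeListAssignment r L →
    ∃ c : G.EdgeLabeling ℕ, IsListEdgeColouring L c ∧ RainbowConnected c}

/-- The list strong rainbow connection number of a connected graph: the minimum positive integer
`r` such that every `r`-edge-list assignment `L` admits a strongly rainbow connected
`L`-edge-colouring. -/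
noncomputable def listStrongRainbowConnectionNumber (G : SimpleGraph V) : ℕ :=
  sInf {r : ℕ | 1 ≤ r ∧ ∀ L : G.edgeSet → Set ℕ, IsEdgeListAssignment r L →
    ∃ c : G.EdgeLabeling ℕ, IsListEdgeColouring L c ∧ StronglyRainbowConnected c}

/-- The Petersen graph: the vertices are the two-element subsets of a five-element set, and two of
them are adjacent if they are disjoint. -/
def petersenGraph : SimpleGraph {s : Finset (Fin 5) // s.card = 2} where
  Adj s t := Disjoint s.1 t.1
  symm := ⟨fun _ _ h => h.symm⟩
  loopless := ⟨fun s h => by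
    have h0 : s.1 = ∅ := by simpa using h
    have h2 := s.2
    simp [h0] at h2⟩

end ListRainbow

/-! The Petersen graph has diameter two and girth five, so non-adjacent vertices have exactly one
common neighbour. A colouring is therefore strongly rainbow connected exactly when it is a proper
edge-colouring. The graph is not 3-edge-colourable, which rules out three colours for the strong
version. With only two colours, rainbow paths have length at most two, so rainbow connection would
also force a proper colouring, impossible at a vertex of degree three. Both upper bounds come from
the Alon–Tarsi method: if the product of `X a - X b` over the pairs to be separated has a nonzero
coefficient at a monomial with all exponents below `r`, then lists of size `r` suffice. Adjacent
edge pairs give a suitable monomial with exponents at most 3. For `r = 3` they cannot, so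
`rainbowEdgePairs` trades four of the geodesics for paths of length three. -/

namespace ListRainbow

/-! ### The Alon–Tarsi method with a computable coefficient -/

section AlonTarsi

open MvPolynomial

variable {ι : Type*}

/-- The product of the differences `X a - X b` over the pairs `(a, b)` in `l`. -/
noncomputable def graphPolynomial (l : List (ι × ι)) : MvPolynomial ι ℤ :=
  (l.map fun e => X e.1 - X e.2).prod

theorem graphPolynomial_isHomogeneous (l : List (ι × ι)) :
    (graphPolynomial l).IsHomogeneous l.length := by
  induction l with
  | nil => simpa [graphPolynomial] using isHomogeneous_one ι ℤ
  | cons e l ih =>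
    have h : graphPolynomial (e :: l) = (X e.1 - X e.2) * graphPolynomial l := by
      simp [graphPolynomial]
    rw [h, List.length_cons, add_comm]
    exact ((isHomogeneous_X ℤ e.1).sub (isHomogeneous_X ℤ e.2)).mul ih

variable [DecidableEq ι]

/-- The number of pairs in `l`, with multiplicity, that contain `i`. -/
def pairDegree (l : List (ι × ι)) (i : ι) : ℕ :=
  (l.map Prod.fst).count i + (l.map Prod.snd).count i

/-- The signed number of ways to choose one entry of every pair in `l` so that `i` is chosen `m i`
times; the sign counts the second entries. Branches rejecting some `i` more than `s i` times are
cut off. -/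
def signedChoiceCount [Fintype ι] : List (ι × ι) → (ι → ℕ) → (ι → ℕ) → ℤ
  | [], m, _ => if ∀ i, m i = 0 then 1 else 0
  | (a, b) :: l, m, s =>
    (match m a, s b with
      | x + 1, y + 1 => signedChoiceCount l (Function.update m a x) (Function.update s b y)
      | _, _ => 0) -
    (match m b, s a with
      | x + 1, y + 1 => signedChoiceCount l (Function.update m b x) (Function.update s a y)
      | _, _ => 0)

theorem coeff_graphPolynomial_cons (a b : ι) (l : List (ι × ι)) (t : ι →₀ ℕ) :
    coeff t (graphPolynomial ((a, b) :: l)) =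
      (if t a = 0 then 0 else coeff (t - Finsupp.single a 1) (graphPolynomial l)) -
      (if t b = 0 then 0 else coeff (t - Finsupp.single b 1) (graphPolynomial l)) := by
  have h : graphPolynomial ((a, b) :: l) =
      X a * graphPolynomial l - X b * graphPolynomial l := by
    simp [graphPolynomial, sub_mul]
  rw [h, coeff_sub, coeff_X_mul', coeff_X_mul']
  simp [Finsupp.mem_support_iff]

/-- Each factor raises the exponent of a variable by at most one. This is what makes pruning the
count harmless. -/
theorem le_pairDegree_of_coeff_ne_zero {l : List (ι × ι)} {t : ι →₀ ℕ}
    (h : coeff t (graphPolynomial l) ≠ 0) (i : ι) : t i ≤ pairDegree l i := by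
  induction l generalizing t with
  | nil =>
    simp only [graphPolynomial, List.map_nil, List.prod_nil, coeff_one] at h
    have : t = 0 := by by_contra h'; exact h (if_neg fun h'' => h' h''.symm)
    simp [this]
  | cons e l ih =>
    obtain ⟨a, b⟩ := e
    rw [coeff_graphPolynomial_cons] at h
    have key : (t a ≠ 0 ∧ coeff (t - Finsupp.single a 1) (graphPolynomial l) ≠ 0) ∨
        (t b ≠ 0 ∧ coeff (t - Finsupp.single b 1) (graphPolynomial l) ≠ 0) := by
      by_contra! hc
      apply h
      rw [ite_eq_left_iff.2 hc.1, ite_eq_left_iff.2 hc.2, sub_zero]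
    simp only [pairDegree, List.map_cons, List.count_cons] at ih ⊢
    rcases key with ⟨-, h'⟩ | ⟨-, h'⟩ <;>
    · have := ih h'
      simp only [Finsupp.tsub_apply, Finsupp.single_apply] at this
      simp only [beq_iff_eq]
      split_ifs at this ⊢ <;> omega

/-- Expanding the first factor gives the recursion. The bound `hs` is preserved along it, and
ensures that a branch is cut off only when its coefficient is zero. -/
theorem signedChoiceCount_eq_coeff [Fintype ι] (l : List (ι × ι)) (hl : ∀ e ∈ l, e.1 ≠ e.2)
    (t : ι →₀ ℕ) (s : ι → ℕ) (hs : ∀ i, pairDegree l i ≤ t i + s i) :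
    signedChoiceCount l t s = coeff t (graphPolynomial l) := by
  induction l generalizing t s with
  | nil =>
    simp only [signedChoiceCount, graphPolynomial, List.map_nil, List.prod_nil, coeff_one]
    congr 1
    rw [eq_comm (a := (0 : ι →₀ ℕ)), Finsupp.ext_iff]
    rfl
  | cons e l ih =>
    obtain ⟨a, b⟩ := e
    have branch : ∀ a b : ι, a ≠ b →
        (∀ i, pairDegree l i + (if a = i then 1 else 0) + (if b = i then 1 else 0) ≤ t i + s i) →
        (match t a, s b with
          | x + 1, y + 1 => signedChoiceCount l (Function.update t a x) (Function.update s b y)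
          | _, _ => 0) =
        if t a = 0 then 0 else coeff (t - Finsupp.single a 1) (graphPolynomial l) := by
      intro a b hab hd
      split
      next x y hx hy =>
        rw [if_neg (by omega)]
        have hu : Function.update t a x = ⇑(t - Finsupp.single a 1 : ι →₀ ℕ) := by
          ext i
          by_cases hi : i = a
          · subst hi; simp [hx]
          · simp [hi]
        rw [hu]
        refine ih (fun e he => hl e (List.mem_cons_of_mem _ he)) _ _ fun i => ?_
        have h1 := hd i
        rw [← hu]
        by_cases hi : i = a
        · subst hi
          simp [hab, hx] at h1 ⊢
          split_ifs at h1 <;> simp_all; omega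
        · by_cases hj : i = b
          · subst hj; simp [hi, hy] at h1 ⊢; split_ifs at h1 <;> omega
          · simp [hi, hj, Ne.symm hi, Ne.symm hj] at h1 ⊢; omega
      next hx =>
        split_ifs with h0
        · rfl
        · by_contra hne
          have h1 := le_pairDegree_of_coeff_ne_zero (Ne.symm hne) b
          have h2 := hd b
          -- With no rejections of `b` left, `hd` makes the exponent of `b` exceed the number of
          -- remaining factors containing it.
          have hsb : s b = 0 := by
            by_contra hsb
            exact hx (t a - 1) (s b - 1) (by omega) (by omega)
          simp [hab, hsb] at h1 h2
          omega
    have hab : a ≠ b := hl (a, b) List.mem_cons_self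
    simp only [pairDegree, List.map_cons, List.count_cons, beq_iff_eq] at hs
    rw [signedChoiceCount, coeff_graphPolynomial_cons, branch a b hab, branch b a hab.symm]
    all_goals
      intro i
      have := hs i
      simp only [pairDegree]
      omega

/-- The Alon–Tarsi criterion for list colourings. -/
theorem exists_listColouring_of_signedChoiceCount_ne_zero [Fintype ι] (l : List (ι × ι))
    (hl : ∀ e ∈ l, e.1 ≠ e.2) (m s : ι → ℕ) (hs : ∀ i, pairDegree l i ≤ m i + s i)
    (hc : signedChoiceCount l m s ≠ 0) (L : ι → Set ℕ) (hL : ∀ i, (m i : ℕ∞) < (L i).encard) :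
    ∃ c : ι → ℕ, (∀ i, c i ∈ L i) ∧ ∀ e ∈ l, c e.1 ≠ c e.2 := by
  obtain ⟨t, rfl⟩ : ∃ t : ι →₀ ℕ, ⇑t = m := ⟨Finsupp.equivFunOnFinite.symm m, by simp⟩
  rw [signedChoiceCount_eq_coeff l hl t s hs] at hc
  -- By homogeneity, every monomial that occurs has top degree, as the Nullstellensatz requires.
  have hdeg : (graphPolynomial l).totalDegree = t.degree := by
    rw [(graphPolynomial_isHomogeneous l).totalDegree (fun h0 => hc (by simp [h0]))]
    by_contra hne
    exact hc ((graphPolynomial_isHomogeneous l).coeff_eq_zero (Ne.symm hne))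
  -- The lists may be infinite, so they are cut down to `t i + 1` elements.
  have hfin : ∀ i, ∃ S : Finset ℕ, (S : Set ℕ) ⊆ L i ∧ t i < S.card := by
    intro i
    obtain ⟨S, hS, hcard⟩ := Set.exists_subset_encard_eq (Order.add_one_le_of_lt (hL i))
    have hSfin : S.Finite := Set.finite_of_encard_eq_coe (k := t i + 1) (by simpa using hcard)
    refine ⟨hSfin.toFinset, by simpa using hS, ?_⟩
    rw [hSfin.encard_eq_coe_toFinset_card] at hcard
    have : hSfin.toFinset.card = t i + 1 := by exact_mod_cast hcard
    omega
  choose S hSL hScard using hfin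
  obtain ⟨c, hcS, hne⟩ := combinatorial_nullstellensatz_exists_eval_nonzero
    (graphPolynomial l) t hc hdeg (fun i => (S i).map Nat.castEmbedding) (by simpa using hScard)
  have hcast : ∀ i, ∃ x ∈ S i, (x : ℤ) = c i := by simpa using hcS
  choose d hdS hdc using hcast
  refine ⟨d, fun i => hSL i (hdS i), fun e he heq => hne ?_⟩
  rw [graphPolynomial, map_list_prod, List.prod_eq_zero_iff, List.mem_map]
  refine ⟨X e.1 - X e.2, List.mem_map.2 ⟨e, he, rfl⟩, ?_⟩
  simp [← hdc, heq]

end AlonTarsi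

/-! ### Rainbow paths in a general graph -/

section Paths

variable {V : Type*} {G : SimpleGraph V}

theorem isRainbow_nil (c : G.EdgeLabeling ℕ) (u : V) :
    IsRainbow c (SimpleGraph.Walk.nil : G.Walk u u) := by
  intro e he
  simp at he

theorem isRainbow_toWalk (c : G.EdgeLabeling ℕ) {u v : V} (h : G.Adj u v) :
    IsRainbow c h.toWalk := by
  rintro ⟨e, he⟩ h1 ⟨f, hf⟩ h2 -
  simp at h1 h2
  simp [h1, h2]

theorem exists_rainbow_path_of_two_edges (c : G.EdgeLabeling ℕ) {u w v : V} (h₁ : G.Adj u w)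
    (h₂ : G.Adj w v) (huv : u ≠ v) (hc : c ⟨s(u, w), h₁⟩ ≠ c ⟨s(w, v), h₂⟩) :
    ∃ p : G.Walk u v, p.IsPath ∧ p.length = 2 ∧ IsRainbow c p := by
  refine ⟨.cons h₁ (.cons h₂ .nil), ?_, rfl, ?_⟩
  · simp [h₁.ne, h₂.ne, huv]
  · rintro ⟨e, he⟩ h1 ⟨f, hf⟩ h2 hef
    simp at h1 h2
    rcases h1 with rfl | rfl <;> rcases h2 with rfl | rfl <;>
      first
      | rfl
      | exact absurd hef hc
      | exact absurd hef.symm hc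

theorem exists_rainbow_path_of_three_edges (c : G.EdgeLabeling ℕ) {u x y v : V}
    (h₁ : G.Adj u x) (h₂ : G.Adj x y) (h₃ : G.Adj y v) (huv : u ≠ v) (hnadj : ¬ G.Adj u v)
    (hc₁₂ : c ⟨s(u, x), h₁⟩ ≠ c ⟨s(x, y), h₂⟩) (hc₂₃ : c ⟨s(x, y), h₂⟩ ≠ c ⟨s(y, v), h₃⟩)
    (hc₁₃ : c ⟨s(u, x), h₁⟩ ≠ c ⟨s(y, v), h₃⟩) :
    ∃ p : G.Walk u v, p.IsPath ∧ IsRainbow c p := by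
  refine ⟨.cons h₁ (.cons h₂ (.cons h₃ .nil)), ?_, ?_⟩
  · have huy : u ≠ y := by rintro rfl; exact hnadj h₃
    have hxv : x ≠ v := by rintro rfl; exact hnadj h₁
    simp [h₁.ne, h₂.ne, h₃.ne, huv, huy, hxv]
  · rintro ⟨e, he⟩ h1 ⟨f, hf⟩ h2 hef
    simp at h1 h2
    rcases h1 with rfl | rfl | rfl <;> rcases h2 with rfl | rfl | rfl <;>
      first
      | rfl
      | exact absurd hef ‹_›
      | exact absurd hef.symm ‹_›

/-- A rainbow path is no longer than the number of available colours. -/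
theorem IsRainbow.length_le {c : G.EdgeLabeling ℕ} {k : ℕ} (hc : ∀ e, c e < k) {u v : V}
    {p : G.Walk u v} (hp : p.IsPath) (hr : IsRainbow c p) : p.length ≤ k := by
  classical
  have hcard : p.edges.toFinset.attach.card = p.length := by
    rw [Finset.card_attach, List.toFinset_card_of_nodup hp.edges_nodup,
      SimpleGraph.Walk.length_edges]
  rw [← hcard, ← Finset.card_range k]
  have hmem : ∀ e : {e // e ∈ p.edges.toFinset}, e.1 ∈ p.edges := fun e =>
    List.mem_toFinset.1 e.2
  refine Finset.card_le_card_of_injOn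
    (fun e => c ⟨e.1, p.edges_subset_edgeSet (hmem e)⟩) (fun e _ => by simpa using hc _) ?_
  intro e _ f _ hef
  have := @hr ⟨e.1, _⟩ (hmem e) ⟨f.1, _⟩ (hmem f) hef
  exact Subtype.ext (congrArg (fun e : G.edgeSet => e.1) this)

/-- If `w` is the only common neighbour of `u` and `v`, a rainbow path of length two from `u` to
`v` forces different colours on the edges `uw` and `wv`. -/
theorem IsRainbow.colour_ne {c : G.EdgeLabeling ℕ} {u w v : V} (h₁ : G.Adj u w) (h₂ : G.Adj w v)
    (huv : u ≠ v) (huniq : ∀ x, G.Adj u x → G.Adj x v → x = w) {p : G.Walk u v}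
    (hlen : p.length = 2) (hr : IsRainbow c p) : c ⟨s(u, w), h₁⟩ ≠ c ⟨s(w, v), h₂⟩ := by
  intro hc
  match p, hlen, hr with
  | .cons (v := x) h (.cons h' .nil), _, hr =>
    obtain rfl := huniq x h h'
    have := @hr ⟨s(u, x), h₁⟩ (by simp) ⟨s(x, v), h₂⟩ (by simp) hc
    have := congrArg Subtype.val this
    simp [huv, h₁.ne] at this

end Paths

/-! ### Finite computations on the Petersen graph -/

section Petersen

instance : DecidableRel petersenGraph.Adj := fun s t =>
  inferInstanceAs (Decidable (Disjoint s.1 t.1))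

theorem petersenGraph_exists_common_neighbour : ∀ u v, u ≠ v → ¬ petersenGraph.Adj u v →
    ∃ w, petersenGraph.Adj u w ∧ petersenGraph.Adj w v := by
  decide +kernel

theorem petersenGraph_common_neighbour_unique : ∀ u v, u ≠ v →
    ∀ w, petersenGraph.Adj u w → petersenGraph.Adj w v → ¬ petersenGraph.Adj u v ∧
      ∀ x, petersenGraph.Adj u x → petersenGraph.Adj x v → x = w := by
  decide +kernel

/-- The two-element set `{a, b}` as a vertex of the Petersen graph. -/
def petersenVertex (a b : Fin 5) (h : a ≠ b := by decide) :
    {s : Finset (Fin 5) // s.card = 2} :=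
  ⟨{a, b}, Finset.card_pair h⟩

/-- An enumeration of the edges of the Petersen graph. -/
def petersenEdgeEnds : Fin 15 →
    {s : Finset (Fin 5) // s.card = 2} × {s : Finset (Fin 5) // s.card = 2} :=
  ![(petersenVertex 0 1, petersenVertex 2 3), (petersenVertex 0 1, petersenVertex 2 4),
    (petersenVertex 0 1, petersenVertex 3 4), (petersenVertex 0 2, petersenVertex 1 3),
    (petersenVertex 0 2, petersenVertex 1 4), (petersenVertex 0 2, petersenVertex 3 4),
    (petersenVertex 0 3, petersenVertex 1 2), (petersenVertex 0 3, petersenVertex 1 4),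
    (petersenVertex 0 3, petersenVertex 2 4), (petersenVertex 0 4, petersenVertex 1 2),
    (petersenVertex 0 4, petersenVertex 1 3), (petersenVertex 0 4, petersenVertex 2 3),
    (petersenVertex 1 2, petersenVertex 3 4), (petersenVertex 1 3, petersenVertex 2 4),
    (petersenVertex 1 4, petersenVertex 2 3)]

theorem petersenEdgeEnds_adj :
    ∀ i, petersenGraph.Adj (petersenEdgeEnds i).1 (petersenEdgeEnds i).2 := by
  decide +kernel

/-- The `i`-th edge of the Petersen graph. -/
def petersenEdge (i : Fin 15) : petersenGraph.edgeSet :=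
  ⟨s((petersenEdgeEnds i).1, (petersenEdgeEnds i).2), petersenEdgeEnds_adj i⟩

theorem petersenEdge_injective : Function.Injective petersenEdge := by
  have h : ∀ i j, (petersenEdge i).1 = (petersenEdge j).1 → i = j := by decide +kernel
  exact fun i j hij => h i j (congrArg Subtype.val hij)

theorem petersenEdge_surjective : Function.Surjective petersenEdge := by
  have h : ∀ u v, petersenGraph.Adj u v → ∃ i, (petersenEdge i).1 = s(u, v) := by decide +kernel
  rintro ⟨e, he⟩
  induction e with
  | h u v =>
    obtain ⟨i, hi⟩ := h u v he
    exact ⟨i, Subtype.ext hi⟩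

/-- A list colouring of the indices of the edges gives a list colouring of the edges. -/
theorem exists_isListEdgeColouring_of_index (L : petersenGraph.edgeSet → Set ℕ)
    {c : Fin 15 → ℕ} (hc : ∀ i, c i ∈ L (petersenEdge i)) :
    ∃ c' : petersenGraph.EdgeLabeling ℕ, IsListEdgeColouring L c' ∧
      ∀ i, c' (petersenEdge i) = c i := by
  let φ := Equiv.ofBijective petersenEdge ⟨petersenEdge_injective, petersenEdge_surjective⟩
  have hφ : ∀ i, φ.symm (petersenEdge i) = i := φ.symm_apply_apply
  refine ⟨fun e => c (φ.symm e), fun e => ?_, fun i => congrArg c (hφ i)⟩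
  obtain ⟨i, rfl⟩ := petersenEdge_surjective e
  simpa only [hφ] using hc i

/-- The pairs of adjacent edges of the Petersen graph. -/
def adjacentEdgePairs : List (Fin 15 × Fin 15) :=
  [(10, 11), (6, 12), (3, 10), (0, 11), (11, 14), (0, 14), (3, 4), (4, 14), (10, 13), (3, 13),
    (9, 12), (9, 10), (9, 11), (6, 9), (6, 7), (7, 14), (4, 7), (2, 12), (0, 2), (6, 8), (8, 13),
    (7, 8), (5, 12), (3, 5), (4, 5), (2, 5), (0, 1), (1, 13), (1, 2), (1, 8)]

/-- Pairs of edges of the Petersen graph such that a colouring that separates each of them is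
rainbow connected: four pairs of adjacent edges are dropped, and each of them is replaced by
the two end edges of the other path in a `5`-cycle through it. -/
def rainbowEdgePairs : List (Fin 15 × Fin 15) :=
  [(3, 13), (7, 8), (7, 14), (3, 10), (3, 5), (3, 4), (4, 14), (4, 5), (6, 7), (6, 10), (5, 6),
    (5, 12), (6, 12), (11, 14), (10, 11), (9, 10), (6, 9), (9, 12), (9, 11), (2, 5), (2, 12),
    (1, 8), (1, 13), (1, 12), (1, 11), (1, 2), (0, 14), (0, 11), (0, 2), (0, 1)]

/-- The exponents are at most 3 and sum to 30, the number of pairs. The rejection bounds complement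
them to 4, since each edge meets four others. -/
theorem signedChoiceCount_adjacentEdgePairs : signedChoiceCount adjacentEdgePairs
    ![1, 3, 3, 1, 3, 3, 2, 3, 3, 3, 0, 1, 0, 2, 2]
    ![3, 1, 1, 3, 1, 1, 2, 1, 1, 1, 4, 3, 4, 2, 2] = -2 := by
  decide +kernel

/-- There are 30 pairs on 15 edges, so the only monomial of the right degree with exponents at most
2 is the one with all exponents 2. -/
theorem signedChoiceCount_rainbowEdgePairs : signedChoiceCount rainbowEdgePairs
    (fun _ => 2) (fun i => pairDegree rainbowEdgePairs i - 2) = 6 := by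
  decide +kernel

/-- `i` and `j` form one of the pairs in `l`. -/
def Linked {ι : Type*} (l : List (ι × ι)) (i j : ι) : Prop :=
  (i, j) ∈ l ∨ (j, i) ∈ l

instance {ι : Type*} [DecidableEq ι] (l : List (ι × ι)) : DecidableRel (Linked l) := fun i j =>
  inferInstanceAs (Decidable ((i, j) ∈ l ∨ (j, i) ∈ l))

theorem Linked.ne {ι : Type*} {l : List (ι × ι)} {c : ι → ℕ}
    (hc : ∀ e ∈ l, c e.1 ≠ c e.2) {i j : ι} (h : Linked l i j) : c i ≠ c j :=
  Or.elim h (hc (i, j)) fun h' => (hc (j, i) h').symm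

theorem linked_adjacentEdgePairs : ∀ i u w, (petersenEdge i).1 = s(u, w) →
    ∀ j v, u ≠ v → (petersenEdge j).1 = s(w, v) → Linked adjacentEdgePairs i j := by
  decide +kernel

theorem exists_common_vertex_of_linked : ∀ i j, Linked adjacentEdgePairs i j →
    ∃ u w, (petersenEdge i).1 = s(u, w) ∧ ∃ v, u ≠ v ∧ (petersenEdge j).1 = s(w, v) := by
  decide +kernel

set_option synthInstance.maxHeartbeats 400000 in
set_option synthInstance.maxSize 2000 in
theorem exists_path_of_rainbowEdgePairs : ∀ u v, u ≠ v → ¬ petersenGraph.Adj u v →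
    (∃ w i, (petersenEdge i).1 = s(u, w) ∧ ∃ j, (petersenEdge j).1 = s(w, v) ∧
      Linked rainbowEdgePairs i j) ∨
    (∃ x i, (petersenEdge i).1 = s(u, x) ∧ ∃ y k, (petersenEdge k).1 = s(x, y) ∧
      ∃ j, (petersenEdge j).1 = s(y, v) ∧ Linked rainbowEdgePairs i k ∧
        Linked rainbowEdgePairs k j ∧ Linked rainbowEdgePairs i j) := by
  decide +kernel

theorem petersenEdge_eq {i : Fin 15} {u v : {s : Finset (Fin 5) // s.card = 2}}
    (h : (petersenEdge i).1 = s(u, v)) :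
    ∃ hadj : petersenGraph.Adj u v, (⟨s(u, v), hadj⟩ : petersenGraph.edgeSet) = petersenEdge i :=
  ⟨by rw [← SimpleGraph.mem_edgeSet, ← h]; exact (petersenEdge i).2, Subtype.ext h.symm⟩

set_option synthInstance.maxHeartbeats 400000 in
set_option synthInstance.maxSize 2000 in
/-- The Petersen graph has no proper `3`-edge-colouring. -/
theorem not_three_edge_colourable (c : Fin 15 → Fin 3)
    (hc : ∀ i j, Linked adjacentEdgePairs i j → c i ≠ c j) : False := by
  -- Each inequality follows its variable immediately, and each edge after the first meets an
  -- earlier one, so the exhaustive check prunes early.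
  have h :
    ∀ x0 : Fin 3, ∀ x1 : Fin 3, x1 ≠ x0 → ∀ x2 : Fin 3, x2 ≠ x0 → x2 ≠ x1 → ∀ x5 : Fin 3, x5
      ≠ x2 → ∀ x12 : Fin 3, x12 ≠ x2 → x12 ≠ x5 → ∀ x3 : Fin 3, x3 ≠ x5 → ∀ x4 : Fin 3, x4 ≠
      x5 → x4 ≠ x3 → ∀ x13 : Fin 3, x13 ≠ x1 → x13 ≠ x3 → ∀ x8 : Fin 3, x8 ≠ x1 → x8 ≠ x13 →
      ∀ x6 : Fin 3, x6 ≠ x12 → x6 ≠ x8 → ∀ x7 : Fin 3, x7 ≠ x4 → x7 ≠ x8 → x7 ≠ x6 → ∀ x14 :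
      Fin 3, x14 ≠ x0 → x14 ≠ x4 → x14 ≠ x7 → ∀ x9 : Fin 3, x9 ≠ x12 → x9 ≠ x6 → ∀ x10 : Fin
      3, x10 ≠ x3 → x10 ≠ x13 → x10 ≠ x9 → ∀ x11 : Fin 3, x11 ≠ x0 → x11 ≠ x14 → x11 ≠ x9 →
      x11 ≠ x10 → False := by
    decide +kernel
  exact h (c 0) (c 1) (hc 1 0 (by decide)) (c 2) (hc 2 0 (by decide)) (hc 2 1 (by decide)) (c 5)
    (hc 5 2 (by decide)) (c 12) (hc 12 2 (by decide)) (hc 12 5 (by decide)) (c 3)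
    (hc 3 5 (by decide)) (c 4) (hc 4 5 (by decide)) (hc 4 3 (by decide)) (c 13)
    (hc 13 1 (by decide)) (hc 13 3 (by decide)) (c 8) (hc 8 1 (by decide)) (hc 8 13 (by decide))
    (c 6) (hc 6 12 (by decide)) (hc 6 8 (by decide)) (c 7) (hc 7 4 (by decide))
    (hc 7 8 (by decide)) (hc 7 6 (by decide)) (c 14) (hc 14 0 (by decide)) (hc 14 4 (by decide))
    (hc 14 7 (by decide)) (c 9) (hc 9 12 (by decide)) (hc 9 6 (by decide)) (c 10)
    (hc 10 3 (by decide)) (hc 10 13 (by decide)) (hc 10 9 (by decide)) (c 11)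
    (hc 11 0 (by decide)) (hc 11 14 (by decide)) (hc 11 9 (by decide)) (hc 11 10 (by decide))

/-! ### From separated pairs to rainbow connection, and back -/

theorem petersenGraph_stronglyRainbowConnected {c : petersenGraph.EdgeLabeling ℕ}
    (hc : ∀ i j, Linked adjacentEdgePairs i j → c (petersenEdge i) ≠ c (petersenEdge j)) :
    StronglyRainbowConnected c := by
  intro u v
  by_cases huv : u = v
  · subst huv
    exact ⟨.nil, by simp, by simp, isRainbow_nil c u⟩
  by_cases hadj : petersenGraph.Adj u v
  · exact ⟨hadj.toWalk, by simp [huv], by simp [SimpleGraph.dist_eq_one_iff_adj.2 hadj],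
      isRainbow_toWalk c hadj⟩
  obtain ⟨w, h₁, h₂⟩ := petersenGraph_exists_common_neighbour u v huv hadj
  obtain ⟨i, hi⟩ := petersenEdge_surjective ⟨s(u, w), h₁⟩
  obtain ⟨j, hj⟩ := petersenEdge_surjective ⟨s(w, v), h₂⟩
  have hne := hc i j (linked_adjacentEdgePairs i u w (congrArg Subtype.val hi) j v huv
    (congrArg Subtype.val hj))
  rw [hi, hj] at hne
  obtain ⟨p, hp, hlen, hr⟩ := exists_rainbow_path_of_two_edges c h₁ h₂ huv hne
  refine ⟨p, hp, ?_, hr⟩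
  have hle := SimpleGraph.dist_le p
  have h0 : petersenGraph.dist u v ≠ 0 := fun h0 => huv (p.reachable.dist_eq_zero_iff.1 h0)
  have h1 : petersenGraph.dist u v ≠ 1 := fun h1 => hadj (SimpleGraph.dist_eq_one_iff_adj.1 h1)
  omega

theorem petersenGraph_rainbowConnected {c : petersenGraph.EdgeLabeling ℕ}
    (hc : ∀ i j, Linked rainbowEdgePairs i j → c (petersenEdge i) ≠ c (petersenEdge j)) :
    RainbowConnected c := by
  intro u v
  by_cases huv : u = v
  · subst huv
    exact ⟨.nil, by simp, isRainbow_nil c u⟩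
  by_cases hadj : petersenGraph.Adj u v
  · exact ⟨hadj.toWalk, by simp [huv], isRainbow_toWalk c hadj⟩
  rcases exists_path_of_rainbowEdgePairs u v huv hadj with
    ⟨w, i, hi, j, hj, hij⟩ | ⟨x, i, hi, y, k, hk, j, hj, hik, hkj, hij⟩
  · obtain ⟨h₁, hi'⟩ := petersenEdge_eq hi
    obtain ⟨h₂, hj'⟩ := petersenEdge_eq hj
    obtain ⟨p, hp, -, hr⟩ := exists_rainbow_path_of_two_edges c h₁ h₂ huv
      (by rw [hi', hj']; exact hc i j hij)
    exact ⟨p, hp, hr⟩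
  · obtain ⟨h₁, hi'⟩ := petersenEdge_eq hi
    obtain ⟨h₂, hk'⟩ := petersenEdge_eq hk
    obtain ⟨h₃, hj'⟩ := petersenEdge_eq hj
    exact exists_rainbow_path_of_three_edges c h₁ h₂ h₃ huv hadj
      (by rw [hi', hk']; exact hc i k hik) (by rw [hk', hj']; exact hc k j hkj)
      (by rw [hi', hj']; exact hc i j hij)

/-- If any two vertices at distance two are joined by a rainbow path of length two, then adjacent
edges have different colours. -/
theorem colour_ne_of_rainbow_paths {c : petersenGraph.EdgeLabeling ℕ}
    (hc : ∀ u v, u ≠ v → petersenGraph.dist u v = 2 →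
      ∃ p : petersenGraph.Walk u v, p.length = 2 ∧ IsRainbow c p)
    (i j : Fin 15) (hij : Linked adjacentEdgePairs i j) :
    c (petersenEdge i) ≠ c (petersenEdge j) := by
  obtain ⟨u, w, hi, v, huv, hj⟩ := exists_common_vertex_of_linked i j hij
  obtain ⟨h₁, hi'⟩ := petersenEdge_eq hi
  obtain ⟨h₂, hj'⟩ := petersenEdge_eq hj
  obtain ⟨hadj, huniq⟩ := petersenGraph_common_neighbour_unique u v huv w h₁ h₂
  let q : petersenGraph.Walk u v := .cons h₁ (.cons h₂ .nil)
  have hle : petersenGraph.dist u v ≤ 2 := SimpleGraph.dist_le q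
  have h0 : petersenGraph.dist u v ≠ 0 := fun h0 => huv (q.reachable.dist_eq_zero_iff.1 h0)
  have h1 : petersenGraph.dist u v ≠ 1 := fun h1 => hadj (SimpleGraph.dist_eq_one_iff_adj.1 h1)
  obtain ⟨p, hlen, hr⟩ := hc u v huv (by omega)
  rw [← hi', ← hj']
  exact hr.colour_ne h₁ h₂ huv huniq hlen

/-! ### The two list numbers -/

theorem isEdgeListAssignment_Iio {V : Type*} {G : SimpleGraph V} {r k : ℕ} (h : r ≤ k) :
    IsEdgeListAssignment r (fun _ : G.edgeSet => Set.Iio k) := by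
  intro e
  have : (Set.Iio k).encard = k := by
    rw [← Finset.coe_Iio, Set.encard_coe_eq_coe_finsetCard, Nat.card_Iio]
  rw [this]
  exact_mod_cast h

theorem listRainbowConnectionNumber_petersenGraph :
    listRainbowConnectionNumber petersenGraph = 3 := by
  refine IsLeast.csInf_eq ⟨⟨by norm_num, fun L hL => ?_⟩, ?_⟩
  · obtain ⟨c, hcL, hc⟩ := exists_listColouring_of_signedChoiceCount_ne_zero rainbowEdgePairs
      (by decide +kernel) (fun _ => 2) (fun i => pairDegree rainbowEdgePairs i - 2)
      (fun i => by omega) (by rw [signedChoiceCount_rainbowEdgePairs]; norm_num)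
      (fun i => L (petersenEdge i))
      (fun i => lt_of_lt_of_le (by norm_num) (hL (petersenEdge i)))
    obtain ⟨c', hc'L, hc'⟩ := exists_isListEdgeColouring_of_index L hcL
    refine ⟨c', hc'L, petersenGraph_rainbowConnected fun i j hij => ?_⟩
    rw [hc', hc']
    exact hij.ne hc
  · rintro r ⟨-, hr⟩
    by_contra! hlt
    obtain ⟨c, hcL, hc⟩ := hr _ (isEdgeListAssignment_Iio (k := 2) (by omega))
    -- Two colours bound the path length above by 2, and the distance bounds it below.
    have hne := colour_ne_of_rainbow_paths (c := c) fun u v huv hd => by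
      obtain ⟨p, hp, hrb⟩ := hc u v
      have h1 := hrb.length_le hcL hp
      have h2 := SimpleGraph.dist_le p
      exact ⟨p, by omega, hrb⟩
    -- Edges 0, 1, 2 are the three edges at the vertex `{0, 1}`.
    have h01 := hne 0 1 (by decide)
    have h02 := hne 0 2 (by decide)
    have h12 := hne 1 2 (by decide)
    have h0 : c (petersenEdge 0) < 2 := hcL _
    have h1 : c (petersenEdge 1) < 2 := hcL _
    have h2 : c (petersenEdge 2) < 2 := hcL _
    omega

theorem listStrongRainbowConnectionNumber_petersenGraph :
    listStrongRainbowConnectionNumber petersenGraph = 4 := by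
  refine IsLeast.csInf_eq ⟨⟨by norm_num, fun L hL => ?_⟩, ?_⟩
  · obtain ⟨c, hcL, hc⟩ := exists_listColouring_of_signedChoiceCount_ne_zero adjacentEdgePairs
      (by decide +kernel) ![1, 3, 3, 1, 3, 3, 2, 3, 3, 3, 0, 1, 0, 2, 2]
      ![3, 1, 1, 3, 1, 1, 2, 1, 1, 1, 4, 3, 4, 2, 2] (by decide +kernel)
      (by rw [signedChoiceCount_adjacentEdgePairs]; norm_num) (fun i => L (petersenEdge i))
      (fun i => lt_of_lt_of_le
        (Nat.cast_lt.2 ((by decide : ∀ i : Fin 15,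
          ![1, 3, 3, 1, 3, 3, 2, 3, 3, 3, 0, 1, 0, 2, 2] i < 4) i)) (hL (petersenEdge i)))
    obtain ⟨c', hc'L, hc'⟩ := exists_isListEdgeColouring_of_index L hcL
    refine ⟨c', hc'L, petersenGraph_stronglyRainbowConnected fun i j hij => ?_⟩
    rw [hc', hc']
    exact hij.ne hc
  · rintro r ⟨-, hr⟩
    by_contra! hlt
    obtain ⟨c, hcL, hc⟩ := hr _ (isEdgeListAssignment_Iio (k := 3) (by omega))
    have hne := colour_ne_of_rainbow_paths (c := c) fun u v huv hd => by
      obtain ⟨p, -, hlen, hrb⟩ := hc u v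
      exact ⟨p, hlen.trans hd, hrb⟩
    refine not_three_edge_colourable (fun i => ⟨c (petersenEdge i), hcL _⟩) fun i j hij heq => ?_
    exact hne i j hij (congrArg Fin.val heq)

end Petersen

end ListRainbow

theorem mainTheorem6 :
    ListRainbow.listRainbowConnectionNumber ListRainbow.petersenGraph = 3 ∧
      ListRainbow.listStrongRainbowConnectionNumber ListRainbow.petersenGraph = 4 :=
  ⟨ListRainbow.listRainbowConnectionNumber_petersenGraph,
    ListRainbow.listStrongRainbowConnectionNumber_petersenGraph⟩
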